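/- Let $\mathbb{F}_q$ be a finite field with $q$ elements, let $X/\mathbb{F}_q$ be a smooth projective geometrically connected curve with function field $\mathbb{F}_q(X)$, let $\overline{\mathbb{F}_q(X)}$ be an algebraic closure of $\mathbb{F}_q(X)$, and let $\overline{\mathbb{F}}_q$ be the algebraic closure of $\mathbb{F}_q$ in $\overline{\mathbb{F}_q(X)}$. Put $$\mathbf{D}=\overline{\mathbb{F}_q(X)}\otimes_{\overline{\mathbb{F}}_q}\overline{\mathbb{F}_q(X)},$$ let $\varphi\mapsto\varphi|_\Delta$ be the ring homomorphism $\mathbf{D}\to\overline{\mathbb{F}_q(X)}$ with $(x\otimes y)|_\Delta=xy$ (diagonal evaluation), and let $\Delta\subset\mathbf{D}$ be its kernel, which is a maximal ideal. For $\theta\in\mathrm{Aut}(\overline{\mathbb{F}_q(X)}/\overline{\mathbb{F}}_q)$ let $1\otimes\theta$ be the automorphism of $\mathbf{D}$ with $(1\otimes\theta)(x\otimes y)=x\otimes\theta y$. Then: (i) The ring $\mathbf{D}$ is a domain. (ii) Every nonzero prime ideal of $\mathbf{D}$ is maximal. (iii) The local ring $\mathbf{D}_\Delta$ of $\mathrm{Spec}(\mathbf{D})$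 at $\Delta$ is a valuation ring of rank one which is not discrete. (iv) For every maximal ideal $\mathbf{M}\subset\mathbf{D}$ there is a unique $\theta\in\mathrm{Aut}(\overline{\mathbb{F}_q(X)}/\overline{\mathbb{F}}_q)$ such that $$\mathbf{M}=\ker\left(\varphi\mapsto((1\otimes\theta)\varphi)|_\Delta:\mathbf{D}\to\overline{\mathbb{F}_q(X)}\right).$$ -/

import Mathlib

open AlgebraicGeometry CategoryTheory
open scoped TensorProduct

universe u v

noncomputable section

instance projGradedRing (k : Type u) [Field k] (n : ℕ) :
    GradedRing (MvPolynomial.homogeneousSubmodule (Fin (n + 1)) k) :=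
  MvPolynomial.gradedAlgebra

/-- Projective `n`-space `Proj k[x₀, …, xₙ]` over a field `k`. -/
def projSpace (k : Type u) [Field k] (n : ℕ) : Scheme.{u} :=
  Proj (MvPolynomial.homogeneousSubmodule (Fin (n + 1)) k)

/-- The structure morphism of projective `n`-space over `k`. -/
def projSpaceStr (k : Type u) [Field k] (n : ℕ) :
    projSpace k n ⟶ Spec (CommRingCat.of k) :=
  Proj.toSpecZero (MvPolynomial.homogeneousSubmodule (Fin (n + 1)) k) ≫
    Spec.map (CommRingCat.ofHom
      (algebraMap k (MvPolynomial.homogeneousSubmodule (Fin (n + 1)) k 0)))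

/-- A smooth projective geometrically connected curve over a field `k`.
Integrality is part of the word "curve"; it also follows from the other conditions. -/
structure SmoothProjCurve (k : Type u) [Field k] where
  /-- the underlying scheme -/
  X : Scheme.{u}
  /-- the structure morphism -/
  str : X ⟶ Spec (CommRingCat.of k)
  integral : IsIntegral X
  smooth : SmoothOfRelativeDimension 1 str
  projective : ∃ (n : ℕ) (i : X ⟶ projSpace k n), IsClosedImmersion i ∧
    i ≫ projSpaceStr k n = str
  geomConn : GeometricallyConnected str

namespace SmoothProjCurve

variable {k : Type u} [Field k] (C : SmoothProjCurve k)

instance : IsIntegral C.X := C.integral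

/-- The function field `k(X)` of a curve: the local ring at the generic point. -/
def FunctionField : Type u := C.X.functionField

instance : Field C.FunctionField := inferInstanceAs (Field C.X.functionField)

/-- The inclusion `k → k(X)`: a constant is pulled back to a global function on `X` along the
structure morphism, and its germ is taken at the generic point. -/
def constHom : k →+* C.FunctionField :=
  ((Scheme.ΓSpecIso (CommRingCat.of k)).inv ≫ C.str.appTop ≫
    C.X.presheaf.germ ⊤ (genericPoint C.X) trivial).hom

instance : Algebra k C.FunctionField := C.constHom.toAlgebra

end SmoothProjCurve

/-- `A` is a nondiscrete valuation ring of rank one: a valuation domain whose canonical valuation on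
the fraction field is nontrivial with value group embeddable, as an ordered group, in the positive
reals, and which is not a discrete valuation ring. -/
structure IsNondiscreteRankOneValuationRing (A : Type v) [CommRing A] : Prop where
  isDomain : IsDomain A
  valuationRing : ValuationRing A
  rankOne : Nonempty (ValuationRing.valuation A (FractionRing A)).RankOne
  nondiscrete : ¬ IsDiscreteValuationRing A

section RingD

variable (k : Type u) [Field k] (Ω : Type v) [Field Ω] [Algebra k Ω]

/-- The ring `D = Ω ⊗ Ω`, the tensor product being over the algebraic closure of `k` in `Ω`. -/
abbrev RingD : Type v := Ω ⊗[algebraicClosure k Ω] Ω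

/-- Diagonal evaluation `D → Ω`, `x ⊗ y ↦ x * y`. -/
def diagEval : RingD k Ω →ₐ[algebraicClosure k Ω] Ω :=
  Algebra.TensorProduct.lmul' (algebraicClosure k Ω)

@[simp]
theorem diagEval_tmul (x y : Ω) : diagEval k Ω (x ⊗ₜ y) = x * y :=
  Algebra.TensorProduct.lmul'_apply_tmul x y

/-- The diagonal ideal `Δ`, the kernel of diagonal evaluation. -/
def diagIdeal : Ideal (RingD k Ω) := RingHom.ker (diagEval k Ω)

instance diagIdeal_isMaximal : (diagIdeal k Ω).IsMaximal :=
  RingHom.ker_isMaximal_of_surjective (diagEval k Ω)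
    (fun x => ⟨x ⊗ₜ 1, by simp⟩)

/-- The local ring `D_Δ` of `Spec D` at `Δ`. -/
abbrev LocalRingAtDiag : Type v := Localization.AtPrime (diagIdeal k Ω)

variable {k Ω}

/-- The automorphism `1 ⊗ θ` of `D`, `x ⊗ y ↦ x ⊗ θ y`, for an automorphism `θ` of `Ω` which is
the identity on the algebraic closure of `k` in `Ω`. -/
def oneTensor (θ : Ω ≃ₐ[algebraicClosure k Ω] Ω) :
    RingD k Ω ≃ₐ[algebraicClosure k Ω] RingD k Ω :=
  Algebra.TensorProduct.congr AlgEquiv.refl θ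

@[simp]
theorem oneTensor_tmul (θ : Ω ≃ₐ[algebraicClosure k Ω] Ω) (x y : Ω) :
    oneTensor θ (x ⊗ₜ y) = x ⊗ₜ θ y :=
  Algebra.TensorProduct.map_tmul _ _ x y

end RingD

end

/-! Write K for the algebraically closed field and F for the algebraic closure of the constants in
it. A smooth curve is étale over the affine line near its generic point, so K is algebraic over a
polynomial ring F[X] inside it. Apart from this, only the algebraic closedness of F and K and the
characteristic p > 0 are used.

D = K ⊗ K is a domain: specialising a finitely generated subalgebra of the left factor at a rational
point would turn zero divisors of D into zero divisors of K. Next, D is algebraic over K[X], with X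
acting as X ⊗ 1 and K as the right factor. Modulo a nonzero prime, X ⊗ 1 is therefore algebraic over
the right copy of K, hence lies in it, and then so does the whole left factor
(`bijective_includeRight_quotient`). So nonzero primes are maximal; by symmetry both copies of K map
isomorphically onto D/M, and comparing them gives θ.

For E finite separable over F(X), the ring E ⊗ K is Dedekind, being unramified over a localization
of K[X]. Each element of D has some p^m-th power coming from such a ring, and Frobenius is bijective
on D, so comparability under divisibility passes to the local rings of D by extracting roots
(`exists_mul_eq_mul_tensorProduct`). Dimension one makes the value group archimedean, and p-th roots
exclude a uniformizer. -/

/-! ### Tensor products of domains over an algebraically closed field -/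

section TensorDomain

open Algebra.TensorProduct

/-- Over an algebraically closed field, a nonzero element of a finitely generated domain is
nonzero at some rational point. -/
theorem exists_algHom_apply_ne_zero {F A : Type*} [Field F] [IsAlgClosed F] [CommRing A]
    [IsDomain A] [Algebra F A] [Algebra.FiniteType F A] {a : A} (ha : a ≠ 0) :
    ∃ f : A →ₐ[F] F, f a ≠ 0 := by
  -- By the Nullstellensatz, the residue field of A[1/a] at any maximal ideal is F, and a is a unit
  -- there.
  have : Nontrivial (Localization.Away a) :=
    (IsLocalization.injective (Localization.Away a)
      (powers_le_nonZeroDivisors_of_noZeroDivisors ha)).nontrivial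
  obtain ⟨m, hm⟩ := Ideal.exists_maximal (Localization.Away a)
  let K := Localization.Away a ⧸ m
  let : Field K := Ideal.Quotient.field m
  have : Algebra.FiniteType A (Localization.Away a) :=
    have := IsLocalization.Away.finitePresentation (S := Localization.Away a) a
    inferInstance
  have : Algebra.FiniteType F (Localization.Away a) := .trans (S := A) inferInstance inferInstance
  have : Algebra.FiniteType F K :=
    .of_surjective (Ideal.Quotient.mkₐ F m) (Ideal.Quotient.mkₐ_surjective F m)
  have : Module.Finite F K := finite_of_finite_type_of_isJacobsonRing F K
  let e : F ≃ₐ[F] K := .ofBijective (Algebra.ofId F K) IsAlgClosed.algebraMap_bijective_of_isIntegral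
  let g : A →ₐ[F] K := (Ideal.Quotient.mkₐ F m).comp (IsScalarTower.toAlgHom F A _)
  refine ⟨e.symm.toAlgHom.comp g, fun h ↦ ?_⟩
  have hu : IsUnit (g a) :=
    (IsLocalization.Away.algebraMap_isUnit (S := Localization.Away a) a).map (Ideal.Quotient.mkₐ F m)
  exact hu.ne_zero (by simpa using h)

/-- Expand x and y in an F-basis of B, with coordinates in A. A rational point of A where one
coordinate of each is nonzero sends both to nonzero elements of the domain B. -/
theorem noZeroDivisors_tensorProduct_of_finiteType (F A B : Type*) [Field F] [IsAlgClosed F]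
    [CommRing A] [IsDomain A] [Algebra F A] [Algebra.FiniteType F A]
    [CommRing B] [IsDomain B] [Algebra F B] : NoZeroDivisors (A ⊗[F] B) where
  eq_zero_or_eq_zero_of_mul_eq_zero {x y} hxy := by
    by_contra! h
    let b := Algebra.TensorProduct.basis A (Module.Free.chooseBasis F B)
    obtain ⟨i, hi⟩ : ∃ i, b.repr x i ≠ 0 := by
      by_contra! H
      exact h.1 (b.repr.map_eq_zero_iff.1 (Finsupp.ext H))
    obtain ⟨j, hj⟩ : ∃ i, b.repr y i ≠ 0 := by
      by_contra! H
      exact h.2 (b.repr.map_eq_zero_iff.1 (Finsupp.ext H))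
    obtain ⟨f, hf⟩ := exists_algHom_apply_ne_zero (F := F) (mul_ne_zero hi hj)
    let φ : A ⊗[F] B →ₐ[F] B := Algebra.TensorProduct.lift
      ((Algebra.ofId F B).comp f) (AlgHom.id F B) fun _ _ ↦ Commute.all _ _
    have key (z : A ⊗[F] B) (i) :
        (Module.Free.chooseBasis F B).repr (φ z) i = f (b.repr z i) := by
      induction z with
      | zero => simp
      | add z w hz hw => simp [hz, hw]
      | tmul a c => simp [φ, b, ← Algebra.smul_def, mul_comm (f a), Algebra.ofId_apply]
    rw [map_mul, mul_ne_zero_iff] at hf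
    have hx : φ x ≠ 0 := fun h0 ↦ hf.1 (by rw [← key, h0]; simp)
    have hy : φ y ≠ 0 := fun h0 ↦ hf.2 (by rw [← key, h0]; simp)
    exact mul_ne_zero hx hy (by rw [← map_mul, hxy, map_zero])

/-- Two elements involve only a finitely generated subalgebra of A, and flatness of B keeps its
tensor product inside A ⊗ B. -/
theorem isDomain_tensorProduct_of_isAlgClosed (F A B : Type*) [Field F] [IsAlgClosed F]
    [CommRing A] [IsDomain A] [Algebra F A] [CommRing B] [IsDomain B] [Algebra F B] :
    IsDomain (A ⊗[F] B) := by
  have : NoZeroDivisors (A ⊗[F] B) := ⟨fun {x y} hxy ↦ by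
    obtain ⟨M, hM, x', hx'⟩ := TensorProduct.Algebra.exists_of_fg x
    obtain ⟨N, hN, y', hy'⟩ := TensorProduct.Algebra.exists_of_fg y
    have : Algebra.FiniteType F ↥(M ⊔ N) := (Subalgebra.fg_iff_finiteType _).1 (hM.sup hN)
    have := noZeroDivisors_tensorProduct_of_finiteType F ↥(M ⊔ N) B
    let φ : ↥(M ⊔ N) ⊗[F] B →ₐ[F] A ⊗[F] B :=
      Algebra.TensorProduct.map (M ⊔ N).val (AlgHom.id F B)
    have hφ : Function.Injective φ :=
      Module.Flat.rTensor_preserves_injective_linearMap (M := B) (M ⊔ N).val.toLinearMap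
        Subtype.val_injective
    have mem {P : Subalgebra F A} (hP : P ≤ M ⊔ N) (z : P ⊗[F] B) :
        ∃ w, φ w = LinearMap.rTensor B P.val.toLinearMap z := by
      refine ⟨Algebra.TensorProduct.map (Subalgebra.inclusion hP) (AlgHom.id F B) z, ?_⟩
      induction z with
      | zero => simp
      | add z w hz hw => simp only [map_add, hz, hw]
      | tmul a c => simp [φ]
    obtain ⟨u, hu⟩ := mem le_sup_left x'
    obtain ⟨w, hw⟩ := mem le_sup_right y'
    rw [hx'] at hu
    rw [hy'] at hw
    have huw : u * w = 0 := hφ (by rw [map_mul, hu, hw, hxy, map_zero])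
    exact (mul_eq_zero.1 huw).imp (fun h ↦ by rw [← hu, h, map_zero])
      fun h ↦ by rw [← hw, h, map_zero]⟩
  exact NoZeroDivisors.to_isDomain _

end TensorDomain

/-! ### Quotients by nonzero primes -/

section PrimesOfTensor

open Polynomial Algebra.TensorProduct

variable (F K : Type*) [Field F] [Field K] [Algebra F K]
  [Algebra F[X] K] [IsScalarTower F F[X] K]

/-- The map `K[X] → K ⊗ K` sending `X` to `X ⊗ 1` and a constant `c` to `1 ⊗ c`. -/
noncomputable def polyToTensor : K[X] →+* K ⊗[F] K :=
  eval₂RingHom (includeRight : K →ₐ[F] K ⊗[F] K).toRingHom (algebraMap F[X] K X ⊗ₜ 1)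

theorem polyToTensor_map (f : F[X]) :
    polyToTensor F K (f.map (algebraMap F K)) = algebraMap F[X] K f ⊗ₜ 1 := by
  have : (polyToTensor F K).comp (mapRingHom (algebraMap F K)) =
      (includeLeftRingHom : K →+* K ⊗[F] K).comp (algebraMap F[X] K) := by
    refine Polynomial.ringHom_ext (fun x ↦ ?_) ?_
    · have := (IsScalarTower.algebraMap_apply F F[X] K x).symm
      rw [Polynomial.algebraMap_eq] at this
      simp [polyToTensor, this, tmul_one_eq_one_tmul]
    · simp [polyToTensor]
  exact congr($this f)

/-- K ⊗ K is a domain algebraic over K[X], and a nonzero ideal of such an extension meets the base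
nontrivially. -/
theorem exists_polyToTensor_mem [IsAlgClosed F] [Algebra.IsAlgebraic F[X] K]
    (P : Ideal (K ⊗[F] K)) (hP : P ≠ ⊥) :
    ∃ f : K[X], f ≠ 0 ∧ polyToTensor F K f ∈ P := by
  have := isDomain_tensorProduct_of_isAlgClosed F K K
  let : Algebra K[X] (K ⊗[F] K) := (polyToTensor F K).toAlgebra
  obtain ⟨d, hd, hd0⟩ := Submodule.exists_mem_ne_zero_of_ne_bot hP
  have halg (d : K ⊗[F] K) : IsAlgebraic K[X] d := by
    have left (x : K) : IsAlgebraic K[X] (x ⊗ₜ[F] (1 : K)) := by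
      obtain ⟨p, hp, hpx⟩ := Algebra.IsAlgebraic.isAlgebraic (R := F[X]) x
      refine ⟨p.map (mapRingHom (algebraMap F K)), ?_, ?_⟩
      · rwa [Ne, Polynomial.map_eq_zero_iff]
        exact map_injective _ (algebraMap F K).injective
      · have h2 : (algebraMap K[X] (K ⊗[F] K)).comp (mapRingHom (algebraMap F K)) =
            (includeLeftRingHom : K →+* K ⊗[F] K).comp (algebraMap F[X] K) :=
          RingHom.ext fun f ↦ polyToTensor_map F K f
        have h3 : (x ⊗ₜ[F] (1 : K)) = (includeLeftRingHom : K →+* K ⊗[F] K) x := rfl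
        rw [aeval_def, eval₂_map, h2, h3, ← hom_eval₂, ← aeval_def, hpx, map_zero]
    have right (y : K) : IsAlgebraic K[X] ((1 : K) ⊗ₜ[F] y) := by
      have : (1 : K) ⊗ₜ[F] y = algebraMap K[X] (K ⊗[F] K) (C y) := by
        simp [RingHom.algebraMap_toAlgebra, polyToTensor]
      rw [this]
      exact isAlgebraic_algebraMap _
    induction d with
    | zero => exact isAlgebraic_zero
    | add x y hx hy => exact hx.add hy
    | tmul x y => simpa using (left x).mul (right y)
  have := Ideal.comap_ne_bot_of_algebraic_mem hd0 hd (halg d)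
  obtain ⟨f, hf, hf0⟩ := Submodule.exists_mem_ne_zero_of_ne_bot this
  exact ⟨f, hf0, hf⟩

/-- Modulo a nonzero prime of `K ⊗ K`, the second factor `K` maps isomorphically. -/
theorem bijective_includeRight_quotient [IsAlgClosed F] [IsAlgClosed K] [FaithfulSMul F[X] K]
    [Algebra.IsAlgebraic F[X] K] (P : Ideal (K ⊗[F] K)) [P.IsPrime] (hP : P ≠ ⊥) :
    Function.Bijective ((Ideal.Quotient.mk P).comp
      (includeRight : K →ₐ[F] K ⊗[F] K).toRingHom) := by
  let i₁ : K →+* (K ⊗[F] K) ⧸ P := (Ideal.Quotient.mk P).comp includeLeftRingHom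
  let i₂ : K →+* (K ⊗[F] K) ⧸ P :=
    (Ideal.Quotient.mk P).comp (includeRight : K →ₐ[F] K ⊗[F] K).toRingHom
  let : Algebra K ((K ⊗[F] K) ⧸ P) := i₂.toAlgebra
  have hi : i₁.comp (algebraMap F K) = i₂.comp (algebraMap F K) := by
    ext x
    simp [i₁, i₂, tmul_one_eq_one_tmul]
  -- The quotient is only known to be a domain here, but K[z] is a domain integral over the
  -- algebraically closed K, hence equal to K.
  have mem_range {z} (hz : IsAlgebraic K z) : ∃ s, i₂ s = z := by
    have : Algebra.IsIntegral K (Algebra.adjoin K {z}) :=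
      Algebra.IsIntegral.adjoin fun _ h ↦ Set.mem_singleton_iff.1 h ▸ hz.isIntegral
    obtain ⟨s, hs⟩ := (IsAlgClosed.algebraMap_bijective_of_isIntegral
      (k := K) (K := Algebra.adjoin K {z})).2 ⟨z, Algebra.self_mem_adjoin_singleton K z⟩
    exact ⟨s, congr(Subtype.val $hs)⟩
  obtain ⟨s, hs⟩ : ∃ s, i₂ s = i₁ (algebraMap F[X] K X) := by
    obtain ⟨f, hf, hfP⟩ := exists_polyToTensor_mem F K P hP
    refine mem_range ⟨f, hf, ?_⟩
    rw [← Ideal.Quotient.eq_zero_iff_mem, polyToTensor, coe_eval₂RingHom, hom_eval₂] at hfP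
    exact hfP
  have hs' (f : F[X]) : i₁ (algebraMap F[X] K f) = i₂ (aeval s f) := by
    have : i₁.comp (algebraMap F[X] K) = i₂.comp (aeval s : F[X] →ₐ[F] K).toRingHom := by
      refine Polynomial.ringHom_ext (fun x ↦ ?_) ?_
      · have := (IsScalarTower.algebraMap_apply F F[X] K x).symm
        rw [Polynomial.algebraMap_eq] at this
        simpa [this] using congr($hi x)
      · simp [hs]
    exact congr($this f)
  -- s is transcendental over F, so a nonzero equation over F[X] stays nonzero when X is replaced by
  -- s.
  have hinj : Function.Injective (aeval s : F[X] →ₐ[F] K) := by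
    rw [injective_iff_map_eq_zero]
    intro f hf
    have := hs' f
    rw [hf, map_zero, map_eq_zero_iff _ i₁.injective] at this
    exact (map_eq_zero_iff _ (FaithfulSMul.algebraMap_injective F[X] K)).1 this
  have left (x : K) : ∃ y, i₂ y = i₁ x := by
    obtain ⟨p, hp, hpx⟩ := Algebra.IsAlgebraic.isAlgebraic (R := F[X]) x
    refine mem_range ⟨p.map (aeval s : F[X] →ₐ[F] K).toRingHom, ?_, ?_⟩
    · rwa [Ne, Polynomial.map_eq_zero_iff hinj]
    · have h2 : (algebraMap K ((K ⊗[F] K) ⧸ P)).comp (aeval s : F[X] →ₐ[F] K).toRingHom =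
          i₁.comp (algebraMap F[X] K) := RingHom.ext fun f ↦ (hs' f).symm
      rw [aeval_def, eval₂_map, h2, ← hom_eval₂, ← aeval_def, hpx, map_zero]
  refine ⟨i₂.injective, fun z ↦ ?_⟩
  obtain ⟨d, rfl⟩ := Ideal.Quotient.mk_surjective z
  induction d with
  | zero => exact ⟨0, by simp⟩
  | add x y hx hy =>
    obtain ⟨a, ha⟩ := hx
    obtain ⟨b, hb⟩ := hy
    exact ⟨a + b, by rw [map_add, ha, hb, map_add]⟩
  | tmul x y =>
    obtain ⟨a, ha⟩ := left x
    refine ⟨a * y, ?_⟩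
    have : x ⊗ₜ[F] y = (includeLeftRingHom x) * (includeRight : K →ₐ[F] K ⊗[F] K) y := by simp
    rw [this, map_mul, map_mul]
    exact congr($ha * _)

end PrimesOfTensor

/-! ### Maximal ideals and automorphisms -/

section MaximalIdeals

open Polynomial Algebra.TensorProduct

/-- Some F-linear functional kills 1 but not t; apply it to the left factor. -/
theorem sub_tmul_ne_zero {F K : Type*} [Field F] [Field K] [Algebra F K] {t : K}
    (ht : t ∉ Set.range (algebraMap F K)) : t ⊗ₜ[F] (1 : K) - 1 ⊗ₜ t ≠ 0 := by
  have hmem : t ∉ Submodule.span F {(1 : K)} := by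
    rw [Submodule.mem_span_singleton]
    rintro ⟨a, rfl⟩
    exact ht ⟨a, Algebra.algebraMap_eq_smul_one a⟩
  obtain ⟨f, hf, hfs⟩ := Submodule.exists_le_ker_of_notMem hmem
  intro h
  have h1 : f 1 = 0 := hfs (Submodule.mem_span_singleton_self 1)
  have := congr(TensorProduct.lid F K (LinearMap.rTensor K f $h))
  rw [map_sub, LinearMap.rTensor_tmul, LinearMap.rTensor_tmul, h1] at this
  simp [hf] at this

theorem not_isField_tensorProduct {F K : Type*} [Field F] [Field K] [Algebra F K] {t : K}
    (ht : t ∉ Set.range (algebraMap F K)) : ¬ IsField (K ⊗[F] K) := by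
  intro h
  let := h.toField
  exact sub_tmul_ne_zero ht ((lmul' F (S := K)).toRingHom.injective (by simp))

variable {F K : Type*} [Field F] [Field K] [IsAlgClosed F] [IsAlgClosed K] [Algebra F K]
  [Algebra F[X] K] [IsScalarTower F F[X] K] [FaithfulSMul F[X] K] [Algebra.IsAlgebraic F[X] K]

theorem isMaximal_of_isPrime_tensorProduct (P : Ideal (K ⊗[F] K)) [P.IsPrime] (hP : P ≠ ⊥) :
    P.IsMaximal := by
  rw [Ideal.Quotient.maximal_ideal_iff_isField_quotient]
  exact (RingEquiv.ofBijective _ (bijective_includeRight_quotient F K P hP)).symm.toMulEquiv.isField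
    (Field.toIsField K)

/-- Swapping the factors reduces this to the right-hand case. -/
theorem bijective_includeLeft_quotient (P : Ideal (K ⊗[F] K)) [P.IsPrime] (hP : P ≠ ⊥) :
    Function.Bijective ((Ideal.Quotient.mk P).comp
      (includeLeftRingHom : K →+* K ⊗[F] K)) := by
  refine ⟨RingHom.injective _, fun z ↦ ?_⟩
  obtain ⟨d, rfl⟩ := Ideal.Quotient.mk_surjective z
  let e := Algebra.TensorProduct.comm F K K
  have hP' : P.comap e ≠ ⊥ := by
    obtain ⟨x, hx, hx0⟩ := Submodule.exists_mem_ne_zero_of_ne_bot hP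
    intro h
    have : e.symm x ∈ P.comap e := by simpa [Ideal.mem_comap] using hx
    rw [h, Ideal.mem_bot, map_eq_zero_iff _ e.symm.injective] at this
    exact hx0 this
  have : (P.comap e).IsPrime := Ideal.comap_isPrime e P
  obtain ⟨y, hy⟩ := (bijective_includeRight_quotient F K (P.comap e) hP').2
    (Ideal.Quotient.mk _ (e.symm d))
  refine ⟨y, ?_⟩
  rw [RingHom.comp_apply, Ideal.Quotient.eq] at hy ⊢
  simpa [Ideal.mem_comap, e] using hy

theorem existsUnique_eq_ker_of_isMaximal (M : Ideal (K ⊗[F] K)) [M.IsMaximal] (hM : M ≠ ⊥) :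
    ∃! θ : K ≃ₐ[F] K, M = RingHom.ker
      ((lmul' F).comp (congr AlgEquiv.refl θ : K ⊗[F] K ≃ₐ[F] K ⊗[F] K).toAlgHom) := by
  let i₁ : K ≃ₐ[F] (K ⊗[F] K) ⧸ M := .ofBijective
    ((Ideal.Quotient.mkₐ F M).comp includeLeft) (bijective_includeLeft_quotient M hM)
  let i₂ : K ≃ₐ[F] (K ⊗[F] K) ⧸ M := .ofBijective
    ((Ideal.Quotient.mkₐ F M).comp includeRight) (bijective_includeRight_quotient F K M hM)
  refine ⟨i₂.trans i₁.symm, ?_, ?_⟩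
  · have : (lmul' F).comp (congr AlgEquiv.refl (i₂.trans i₁.symm) :
        K ⊗[F] K ≃ₐ[F] K ⊗[F] K).toAlgHom = i₁.symm.toAlgHom.comp (Ideal.Quotient.mkₐ F M) := by
      ext x
      · have : Ideal.Quotient.mk M (x ⊗ₜ[F] (1 : K)) = i₁ x := rfl
        simp [this]
      · have : Ideal.Quotient.mk M ((1 : K) ⊗ₜ[F] x) = i₂ x := rfl
        simp [this]
    beta_reduce
    rw [this]
    ext x
    simp [RingHom.mem_ker, Ideal.Quotient.eq_zero_iff_mem]
  · intro θ hθ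
    ext y
    -- This element of the kernel determines θ y as the left counterpart of y modulo M.
    have hmem : θ y ⊗ₜ[F] (1 : K) - 1 ⊗ₜ y ∈ M := by
      rw [hθ]
      simp [RingHom.mem_ker]
    have : i₁ (θ y) = i₂ y := Ideal.Quotient.eq.2 hmem
    simp [← this]

end MaximalIdeals

/-! ### Dedekind domains E ⊗ K -/

section DedekindTensor

open Polynomial nonZeroDivisors

theorem RingEquiv.isDedekindDomain_of_equiv {A B : Type*} [CommRing A] [CommRing B]
    [IsDedekindDomain A] (e : A ≃+* B) : IsDedekindDomain B := by
  let : Algebra A B := e.toRingHom.toAlgebra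
  have : IsDomain B := e.symm.toMulEquiv.isDomain
  have : IsLocalization (⊥ : Submonoid A) B := 
    IsLocalization.of_le_isUnit_of_bijective (by simp [Algebra.algebraMapSubmonoid]) e.bijective
  exact IsLocalization.isDedekindDomain A bot_le B

theorem isDedekindDomain_polynomial_tensor (F K : Type*) [Field F] [Field K] [Algebra F K] :
    IsDedekindDomain (F[X] ⊗[F] K) :=
  ((polyEquivTensor F K).toRingEquiv.trans
    (Algebra.TensorProduct.comm F K F[X]).toRingEquiv).isDedekindDomain_of_equiv

/-- F(X) ⊗ K is a localization of F[X] ⊗ K ≅ K[X]. -/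
theorem isDedekindDomain_fractionField_tensor (F K K₀ : Type*) [Field F] [IsAlgClosed F]
    [Field K] [Algebra F K] [Field K₀] [Algebra F K₀] [Algebra F[X] K₀] [IsScalarTower F F[X] K₀]
    [IsFractionRing F[X] K₀] : IsDedekindDomain (K₀ ⊗[F] K) := by
  have := isDedekindDomain_polynomial_tensor F K
  let e : (F[X] ⊗[F] K) ⊗[F[X]] K₀ ≃+* K₀ ⊗[F] K :=
    (Algebra.TensorProduct.comm F[X] (F[X] ⊗[F] K) K₀).toRingEquiv.trans
      (Algebra.TensorProduct.cancelBaseChange F F[X] F[X] K₀ K).toRingEquiv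
  have := isDomain_tensorProduct_of_isAlgClosed F K₀ K
  have : IsDomain ((F[X] ⊗[F] K) ⊗[F[X]] K₀) := e.toMulEquiv.isDomain
  have hle : Algebra.algebraMapSubmonoid (F[X] ⊗[F] K) F[X]⁰ ≤ (F[X] ⊗[F] K)⁰ :=
    map_le_nonZeroDivisors_of_injective _ (FaithfulSMul.algebraMap_injective _ _) le_rfl
  have := IsLocalization.isDedekindDomain (F[X] ⊗[F] K) hle ((F[X] ⊗[F] K) ⊗[F[X]] K₀)
  exact RingEquiv.isDedekindDomain_of_equiv (A := (F[X] ⊗[F] K) ⊗[F[X]] K₀) e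

/-- A separable extension is unramified, and so is its base change to F(X) ⊗ K; this is where
separability is needed. -/
theorem isDedekindDomain_tensor_of_isSeparable (F K K₀ E : Type*) [Field F] [IsAlgClosed F]
    [Field K] [Algebra F K] [Field K₀] [Algebra F K₀] [Algebra F[X] K₀] [IsScalarTower F F[X] K₀]
    [IsFractionRing F[X] K₀] [Field E] [Algebra F E] [Algebra K₀ E] [IsScalarTower F K₀ E]
    [FiniteDimensional K₀ E] [Algebra.IsSeparable K₀ E] : IsDedekindDomain (E ⊗[F] K) := by
  have := isDedekindDomain_fractionField_tensor F K K₀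
  let e : (K₀ ⊗[F] K) ⊗[K₀] E ≃+* E ⊗[F] K :=
    (Algebra.TensorProduct.comm K₀ (K₀ ⊗[F] K) E).toRingEquiv.trans
      (Algebra.TensorProduct.cancelBaseChange F K₀ K₀ E K).toRingEquiv
  have := isDomain_tensorProduct_of_isAlgClosed F E K
  have : IsDomain ((K₀ ⊗[F] K) ⊗[K₀] E) := e.toMulEquiv.isDomain
  have : Algebra.FormallyUnramified K₀ E := .of_isSeparable K₀ E
  have := isDedekindDomain.of_formallyUnramified (K₀ ⊗[F] K) ((K₀ ⊗[F] K) ⊗[K₀] E)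
  exact e.isDedekindDomain_of_equiv

/-- In a Dedekind domain, of any two elements one divides the other up to a factor outside a
given prime. -/
theorem IsDedekindDomain.exists_mul_eq_mul {B : Type*} [CommRing B] [IsDedekindDomain B]
    (q : Ideal B) [q.IsPrime] (a b : B) :
    ∃ u c, u ∉ q ∧ (u * b = c * a ∨ u * a = c * b) := by
  let L := Localization.AtPrime q
  have : IsDomain L := IsLocalization.isDomain_localization q.primeCompl_le_nonZeroDivisors
  have : IsDedekindDomain L :=
    IsLocalization.isDedekindDomain B q.primeCompl_le_nonZeroDivisors L
  have hinj : Function.Injective (algebraMap B L) :=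
    IsLocalization.injective L q.primeCompl_le_nonZeroDivisors
  have hfin : {I : Ideal L | I.IsPrime}.Finite := by
    refine (Set.toFinite {⊥, IsLocalRing.maximalIdeal L}).subset fun I hI ↦ ?_
    by_cases h : I = ⊥
    · exact .inl h
    · exact .inr (IsLocalRing.eq_maximalIdeal (hI.isMaximal h))
  have := IsPrincipalIdealRing.of_finite_primes hfin
  have : ValuationRing L := ValuationRing.iff_local_bezout_domain.2 ⟨inferInstance, inferInstance⟩
  have key {a b : B} (h : algebraMap B L a ∣ algebraMap B L b) : ∃ u c, u ∉ q ∧ u * b = c * a := by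
    obtain ⟨c, hc⟩ := h
    obtain ⟨⟨c, u⟩, rfl⟩ := IsLocalization.mk'_surjective q.primeCompl c
    refine ⟨u, c, u.2, hinj ?_⟩
    rw [map_mul, map_mul, hc, ← IsLocalization.mk'_spec L c u]
    ring
  obtain h | h := ValuationRing.dvd_total (algebraMap B L a) (algebraMap B L b)
  · obtain ⟨u, c, hu, h⟩ := key h
    exact ⟨u, c, hu, .inl h⟩
  · obtain ⟨u, c, hu, h⟩ := key h
    exact ⟨u, c, hu, .inr h⟩

end DedekindTensor

/-! ### Valuation rings of dimension one -/

section RankOne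

variable {A : Type*} [CommRing A] [IsDomain A] [ValuationRing A]

/-- Every prime containing a is the maximal ideal, so b lies in the radical of (a). -/
theorem ValuationRing.exists_dvd_pow (h : ∀ P : Ideal A, P.IsPrime → P ≠ ⊥ → P.IsMaximal)
    {a b : A} (ha : a ≠ 0) (hb : ¬ IsUnit b) : ∃ n : ℕ, a ∣ b ^ n := by
  have : b ∈ (Ideal.span {a}).radical := by
    rw [Ideal.radical_eq_sInf, Submodule.mem_sInf]
    rintro P ⟨haP, hP⟩
    have hP0 : P ≠ ⊥ := by
      rintro rfl
      exact ha (by simpa using haP)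
    rw [IsLocalRing.eq_maximalIdeal (h P hP hP0)]
    exact hb
  obtain ⟨n, hn⟩ := this
  exact ⟨n, Ideal.mem_span_singleton.1 hn⟩

theorem ValuationRing.mulArchimedean_valueGroup (K : Type*) [Field K] [Algebra A K]
    [IsFractionRing A K] (h : ∀ P : Ideal A, P.IsPrime → P ≠ ⊥ → P.IsMaximal) :
    MulArchimedean (ValuationRing.ValueGroup A K) where
  arch x {y} hy := by
    let v := ValuationRing.valuation A K
    have surj (z : ValuationRing.ValueGroup A K) : ∃ k, v k = z := Quotient.mk_surjective z
    have lift (k : K) (hk : v k ≤ 1) : ∃ a, algebraMap A K a = k :=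
      (ValuationRing.mem_integer_iff A K k).1 hk
    have le_one (a : A) : v (algebraMap A K a) ≤ 1 :=
      (ValuationRing.mem_integer_iff A K _).2 ⟨a, rfl⟩
    obtain hx | hx := le_or_gt x 1
    · exact ⟨0, by simpa using hx⟩
    obtain ⟨k, rfl⟩ := surj x
    obtain ⟨l, rfl⟩ := surj y
    -- Elements of value above 1 have their inverses in A, so a ∣ b ^ n becomes v k ≤ v l ^ n.
    obtain ⟨a, ha⟩ := lift k⁻¹ (by rw [map_inv₀]; exact inv_le_one_of_one_le₀ hx.le)
    obtain ⟨b, hb⟩ := lift l⁻¹ (by rw [map_inv₀]; exact inv_le_one_of_one_le₀ hy.le)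
    have hk : k ≠ 0 := by rintro rfl; simp at hx
    have hl : l ≠ 0 := by rintro rfl; simp at hy
    have ha0 : a ≠ 0 := by
      rintro rfl
      exact inv_ne_zero hk (by rw [← ha, map_zero])
    have hbu : ¬ IsUnit b := by
      intro hu
      obtain ⟨c, hc⟩ := hu.exists_right_inv
      have : l = algebraMap A K c := by
        have h1 := congr(algebraMap A K $hc)
        rw [map_mul, hb, map_one, inv_mul_eq_one₀ hl] at h1
        exact h1
      exact (le_one c).not_gt (this ▸ hy)
    obtain ⟨n, c, hc⟩ := ValuationRing.exists_dvd_pow h ha0 hbu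
    refine ⟨n, ?_⟩
    have h1 := congr(algebraMap A K $hc)
    rw [map_mul, map_pow, ha, hb] at h1
    have h2 : k = algebraMap A K c * l ^ n := by
      have h3 : algebraMap A K c = k * l⁻¹ ^ n := by rw [h1, mul_inv_cancel_left₀ hk]
      rw [h3, mul_assoc, ← mul_pow, inv_mul_cancel₀ hl, one_pow, mul_one]
    rw [h2, map_mul, map_pow]
    exact mul_le_of_le_one_left' (le_one c)

theorem ValuationRing.nonempty_rankOne (K : Type*) [Field K] [Algebra A K]
    [IsFractionRing A K] (hA : ¬ IsField A)
    (h : ∀ P : Ideal A, P.IsPrime → P ≠ ⊥ → P.IsMaximal) :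
    Nonempty (ValuationRing.valuation A K).RankOne := by
  have := ValuationRing.mulArchimedean_valueGroup K h
  have : (ValuationRing.valuation A K).IsNontrivial := ⟨by
    obtain ⟨a, ha0, ha⟩ := Ring.exists_not_isUnit_of_not_isField hA
    refine ⟨algebraMap A K a, ?_, fun h1 ↦ ha ?_⟩
    · simpa using ha0
    · obtain ⟨b, hb⟩ := (ValuationRing.mem_integer_iff A K (algebraMap A K a)⁻¹).1
        (by rw [Valuation.mem_integer_iff, map_inv₀, h1, inv_one])
      refine .of_mul_eq_one b (IsFractionRing.injective A K ?_)
      rw [map_mul, hb, map_one, mul_inv_cancel₀]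
      simpa using ha0⟩
  rw [Valuation.nonempty_rankOne_iff_mulArchimedean]
  exact MulArchimedean.comap MonoidWithZeroHom.ValueGroup₀.embedding.toMonoidHom
    MonoidWithZeroHom.ValueGroup₀.embedding_strictMono

end RankOne

/-! ### Roots in characteristic p -/

section Perfect

theorem charP_tensorProduct (F K : Type*) [Field F] [Field K] [Algebra F K] (p : ℕ) [CharP K p] :
    CharP (K ⊗[F] K) p :=
  charP_of_injective_algebraMap (algebraMap K (K ⊗[F] K)).injective p

/-- Frobenius is additive, so it suffices to extract roots of pure tensors, factor by factor. -/
theorem exists_pow_eq_tensorProduct {F K : Type*} [Field F] [Field K] [IsAlgClosed K] [Algebra F K]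
    (p : ℕ) [Fact p.Prime] [CharP K p] (n : ℕ) (d : K ⊗[F] K) :
    ∃ c, c ^ p ^ n = d := by
  have := charP_tensorProduct F K p
  have hp : 0 < p ^ n := pow_pos (Fact.out : p.Prime).pos n
  induction d with
  | zero => exact ⟨0, zero_pow hp.ne'⟩
  | add x y hx hy =>
    obtain ⟨a, ha⟩ := hx
    obtain ⟨b, hb⟩ := hy
    exact ⟨a + b, by rw [add_pow_char_pow, ha, hb]⟩
  | tmul x y =>
    obtain ⟨a, rfl⟩ := IsAlgClosed.exists_pow_nat_eq x hp
    obtain ⟨b, rfl⟩ := IsAlgClosed.exists_pow_nat_eq y hp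
    exact ⟨a ⊗ₜ b, Algebra.TensorProduct.tmul_pow a b _⟩

theorem exists_pow_eq_localization {R : Type*} [CommRing R] {n : ℕ}
    (hn : n ≠ 0) (h : ∀ d : R, ∃ c, c ^ n = d) (P : Ideal R) [P.IsPrime]
    (x : Localization.AtPrime P) : ∃ y, y ^ n = x := by
  obtain ⟨⟨a, s⟩, rfl⟩ := IsLocalization.mk'_surjective P.primeCompl x
  obtain ⟨c, hc⟩ := h a
  obtain ⟨u, hu⟩ := h s
  have huP : u ∈ P.primeCompl := fun huP ↦ s.2 (hu ▸ P.pow_mem_of_mem huP n hn.bot_lt)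
  refine ⟨IsLocalization.mk' _ c ⟨u, huP⟩, ?_⟩
  rw [← IsLocalization.mk'_pow]
  congr 1
  exact Subtype.ext hu

/-- A uniformizer would be a proper power, hence reducible. -/
theorem not_isDiscreteValuationRing_of_exists_pow {A : Type*} [CommRing A] [IsDomain A] {n : ℕ}
    (hn : 1 < n) (h : ∀ x : A, ∃ y, y ^ n = x) : ¬ IsDiscreteValuationRing A := by
  intro _
  obtain ⟨ϖ, hϖ⟩ := IsDiscreteValuationRing.exists_irreducible A
  obtain ⟨y, rfl⟩ := h ϖ
  exact not_irreducible_pow hn.ne' hϖ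

end Perfect

/-! ### Descent to finite separable subextensions -/

section SeparableDescent

variable {F K K₀ : Type*} [Field F] [Field K] [Field K₀] [Algebra F K] [Algebra F K₀]
  [Algebra K₀ K] [IsScalarTower F K₀ K]

/-- The map `E ⊗ K → K ⊗ K` for an intermediate field `E` of `K / K₀`. -/
noncomputable abbrev intermediateTensorMap (F : Type*) [Field F] [Algebra F K] [Algebra F K₀]
    [IsScalarTower F K₀ K] (E : IntermediateField K₀ K) : E ⊗[F] K →ₐ[F] K ⊗[F] K :=
  Algebra.TensorProduct.map (E.val.restrictScalars F) (AlgHom.id F K)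

theorem range_intermediateTensorMap_mono {E E' : IntermediateField K₀ K} (h : E ≤ E') :
    (intermediateTensorMap F E).range ≤ (intermediateTensorMap F E').range := by
  rintro _ ⟨x, rfl⟩
  induction x with
  | zero => simp
  | add x y hx hy => simpa using add_mem hx hy
  | tmul x y => exact ⟨(⟨x, h x.2⟩ : E') ⊗ₜ y, by simp⟩

/-- K is purely inseparable over the separable closure of K₀. Asking for all m ≥ n lets the
exponents of several elements be made equal. -/
theorem exists_pow_mem_range_intermediateTensorMap [Algebra.IsAlgebraic K₀ K]
    (p : ℕ) [Fact p.Prime] [CharP K p] (d : K ⊗[F] K) :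
    ∃ (E : IntermediateField K₀ K) (_ : FiniteDimensional K₀ E) (_ : Algebra.IsSeparable K₀ E)
      (n : ℕ), ∀ m, n ≤ m → d ^ p ^ m ∈ (intermediateTensorMap F E).range := by
  have := charP_tensorProduct F K p
  induction d with
  | zero =>
    exact ⟨⊥, inferInstance, inferInstance, 0, fun m _ ↦ by
      rw [zero_pow (pow_pos (Fact.out : p.Prime).pos m).ne']; exact zero_mem _⟩
  | add x y hx hy =>
    obtain ⟨E, _, _, n, hn⟩ := hx
    obtain ⟨E', _, _, n', hn'⟩ := hy
    refine ⟨E ⊔ E', inferInstance, inferInstance, max n n', fun m hm ↦ ?_⟩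
    rw [add_pow_char_pow]
    exact add_mem (range_intermediateTensorMap_mono le_sup_left (hn m (le_of_max_le_left hm)))
      (range_intermediateTensorMap_mono le_sup_right (hn' m (le_of_max_le_right hm)))
  | tmul x y =>
    have : CharP K₀ p := (algebraMap K₀ K).charP (algebraMap K₀ K).injective p
    obtain ⟨n, z, hz⟩ := IsPurelyInseparable.pow_mem (separableClosure K₀ K) p x
    have hz' : IsSeparable K₀ (x ^ p ^ n) := hz ▸ z.2
    refine ⟨IntermediateField.adjoin K₀ {x ^ p ^ n},
      IntermediateField.adjoin.finiteDimensional (Algebra.IsIntegral.isIntegral _),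
      (IntermediateField.isSeparable_adjoin_simple_iff_isSeparable K₀ K).2 hz', n, fun m hm ↦ ?_⟩
    have hmem : x ^ p ^ m ∈ IntermediateField.adjoin K₀ {x ^ p ^ n} := by
      obtain ⟨j, rfl⟩ := Nat.exists_eq_add_of_le hm
      rw [pow_add, pow_mul]
      exact pow_mem (IntermediateField.mem_adjoin_simple_self K₀ _) _
    rw [Algebra.TensorProduct.tmul_pow]
    exact ⟨(⟨_, hmem⟩ : IntermediateField.adjoin K₀ {x ^ p ^ n}) ⊗ₜ (y ^ p ^ m), by simp⟩

end SeparableDescent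

/-! ### Local rings of K ⊗ K -/

section LocalRings

open Polynomial

variable {F K : Type*} [Field F] [Field K] [IsAlgClosed F] [IsAlgClosed K] [Algebra F K]
  [Algebra F[X] K] [IsScalarTower F F[X] K] [FaithfulSMul F[X] K] [Algebra.IsAlgebraic F[X] K]

/-- The p^m-th powers of a and b come from one Dedekind ring, where the relation holds; its
coefficients have p^m-th roots in K ⊗ K, and injectivity of Frobenius gives the relation for a and b
themselves. -/
theorem exists_mul_eq_mul_tensorProduct (p : ℕ) [Fact p.Prime] [CharP K p]
    (P : Ideal (K ⊗[F] K)) [P.IsPrime] (a b : K ⊗[F] K) :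
    ∃ u c, u ∉ P ∧ (u * b = c * a ∨ u * a = c * b) := by
  let K₀ := FractionRing F[X]
  let : Algebra K₀ K := FractionRing.liftAlgebra F[X] K
  have : IsScalarTower F[X] K₀ K := FractionRing.isScalarTower_liftAlgebra F[X] K
  have : IsScalarTower F K₀ K := .to₁₃₄ F F[X] K₀ K
  have : Algebra.IsAlgebraic K₀ K := (IsFractionRing.comap_isAlgebraic_iff (A := F[X])).1 ‹_›
  have := charP_tensorProduct F K p
  have := isDomain_tensorProduct_of_isAlgClosed F K K
  obtain ⟨E, _, _, n, hn⟩ := exists_pow_mem_range_intermediateTensorMap (F := F) (K₀ := K₀) p a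
  obtain ⟨E', _, _, n', hn'⟩ := exists_pow_mem_range_intermediateTensorMap (F := F) (K₀ := K₀) p b
  have := isDedekindDomain_tensor_of_isSeparable F K K₀ ↥(E ⊔ E')
  let m := max n n'
  let φ := intermediateTensorMap F (E ⊔ E')
  obtain ⟨a', ha'⟩ := range_intermediateTensorMap_mono le_sup_left (hn m (le_max_left _ _))
  obtain ⟨b', hb'⟩ := range_intermediateTensorMap_mono le_sup_right (hn' m (le_max_right _ _))
  obtain ⟨u', c', hu', h⟩ := IsDedekindDomain.exists_mul_eq_mul (P.comap φ) a' b'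
  obtain ⟨u, hu⟩ := exists_pow_eq_tensorProduct p m (φ u')
  obtain ⟨c, hc⟩ := exists_pow_eq_tensorProduct p m (φ c')
  have inj {x y : K ⊗[F] K} (h : x ^ p ^ m = y ^ p ^ m) : x = y :=
    iterateFrobenius_inj (K ⊗[F] K) p m h
  refine ⟨u, c, fun huP ↦ hu' ?_, ?_⟩
  · rw [Ideal.mem_comap, ← hu]
    exact P.pow_mem_of_mem huP _ (pow_pos (Fact.out : p.Prime).pos m)
  · refine h.imp (fun h ↦ inj ?_) (fun h ↦ inj ?_)
    · rw [mul_pow, mul_pow, hu, hc, ← ha', ← hb']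
      exact (map_mul φ _ _).symm.trans (congr(φ $h).trans (map_mul φ _ _))
    · rw [mul_pow, mul_pow, hu, hc, ← ha', ← hb']
      exact (map_mul φ _ _).symm.trans (congr(φ $h).trans (map_mul φ _ _))

theorem isNondiscreteRankOneValuationRing_of_exists_pow {A : Type*} [CommRing A] [IsDomain A]
    [ValuationRing A] {n : ℕ} (hn : 1 < n) (hA : ¬ IsField A)
    (hdim : ∀ Q : Ideal A, Q.IsPrime → Q ≠ ⊥ → Q.IsMaximal) (h : ∀ x : A, ∃ y, y ^ n = x) :
    IsNondiscreteRankOneValuationRing A where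
  isDomain := inferInstance
  valuationRing := inferInstance
  rankOne := ValuationRing.nonempty_rankOne _ hA hdim
  nondiscrete := not_isDiscreteValuationRing_of_exists_pow hn h

theorem isNondiscreteRankOneValuationRing_localization (p : ℕ) [Fact p.Prime] [CharP K p]
    (P : Ideal (K ⊗[F] K)) [P.IsPrime] (hP : P ≠ ⊥) :
    IsNondiscreteRankOneValuationRing (Localization.AtPrime P) := by
  have := isDomain_tensorProduct_of_isAlgClosed F K K
  let A := Localization.AtPrime P
  have : IsDomain A := IsLocalization.isDomain_localization P.primeCompl_le_nonZeroDivisors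
  have hdim (Q : Ideal A) (hQ : Q.IsPrime) (hQ0 : Q ≠ ⊥) : Q.IsMaximal := by
    have h0 : Q.comap (algebraMap (K ⊗[F] K) A) ≠ ⊥ := by
      intro h
      refine hQ0 ?_
      rw [← IsLocalization.map_under P.primeCompl A Q, Ideal.under, h, Ideal.map_bot]
    have : (Q.comap (algebraMap (K ⊗[F] K) A)).IsMaximal := isMaximal_of_isPrime_tensorProduct _ h0
    have hle : Q.comap (algebraMap (K ⊗[F] K) A) ≤ P := by
      intro x hx
      by_contra hxP
      exact hQ.ne_top (Q.eq_top_of_isUnit_mem hx (IsLocalization.map_units A (⟨x, hxP⟩ : P.primeCompl)))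
    -- The contraction of Q is maximal and contained in P, hence equal to P.
    have : Q = IsLocalRing.maximalIdeal A := by
      rw [← IsLocalization.map_under P.primeCompl A Q, Ideal.under,
        this.eq_of_le Ideal.IsPrime.ne_top' hle]
      exact Localization.AtPrime.map_eq_maximalIdeal
    exact this ▸ IsLocalRing.maximalIdeal.isMaximal A
  have hval : ValuationRing A := by
    rw [ValuationRing.iff_dvd_total]
    refine ⟨fun x y ↦ ?_⟩
    obtain ⟨⟨a, s⟩, rfl⟩ := IsLocalization.mk'_surjective P.primeCompl x
    obtain ⟨⟨b, t⟩, rfl⟩ := IsLocalization.mk'_surjective P.primeCompl y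
    obtain ⟨u, c, hu, h⟩ := exists_mul_eq_mul_tensorProduct p P a b
    have key {a b : K ⊗[F] K} {s t : P.primeCompl} (h : u * b = c * a) :
        IsLocalization.mk' A a s ∣ IsLocalization.mk' A b t :=
      ⟨IsLocalization.mk' A (c * s) (⟨u, hu⟩ * t), by
        rw [← IsLocalization.mk'_mul, IsLocalization.mk'_eq_iff_eq]
        congr 1
        push_cast
        linear_combination (s * t : K ⊗[F] K) * h⟩
    exact h.imp key key
  exact isNondiscreteRankOneValuationRing_of_exists_pow (Fact.out : p.Prime).one_lt
    (IsLocalization.AtPrime.not_isField _ hP A) hdim fun x ↦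
      exists_pow_eq_localization (Fact.out : p.Prime).ne_zero
        (fun d ↦ by simpa using exists_pow_eq_tensorProduct p 1 d) P x

end LocalRings

/-! ### A transcendence basis of the function field -/

section FunctionField

/-- The coordinates of an étale map from affine space to a domain form a transcendence basis of
the fraction field. -/
theorem isTranscendenceBasis_of_etale_mvPolynomial {k S L ι : Type*} [Finite ι] [Field k]
    [CommRing S] [IsDomain S] [Field L] [Algebra S L] [IsFractionRing S L] [Algebra k L]
    (g : MvPolynomial ι k →+* S) (hg : g.Etale)
    (h : (algebraMap S L).comp (g.comp MvPolynomial.C) = algebraMap k L) :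
    IsTranscendenceBasis k fun i ↦ algebraMap S L (g (.X i)) := by
  let R := MvPolynomial ι k
  algebraize [g, (algebraMap S L).comp g]
  have : IsScalarTower R S L := .of_algebraMap_eq fun _ ↦ rfl
  have : IsScalarTower k R L := .of_algebraMap_eq fun x ↦ congr($h x).symm
  have : FaithfulSMul R S := inferInstance
  have : FaithfulSMul R L := .trans R S L
  let : Algebra (FractionRing R) L := FractionRing.liftAlgebra R L
  have : IsScalarTower R (FractionRing R) L := FractionRing.isScalarTower_liftAlgebra R L
  -- The extension of fraction fields is unramified and essentially of finite type, hence finite.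
  have : Algebra.FormallyEtale S L := .of_isLocalization (nonZeroDivisors S)
  have : Algebra.FormallyUnramified R L := .comp R S L
  have : Algebra.FormallyUnramified (FractionRing R) L := .of_restrictScalars R _ _
  have : Algebra.EssFiniteType S L := .of_isLocalization L (nonZeroDivisors S)
  have : Algebra.EssFiniteType R L := .comp R S L
  have : Algebra.EssFiniteType (FractionRing R) L := .of_comp R _ _
  have := Algebra.FormallyUnramified.finite_of_free (FractionRing R) L
  have : Algebra.IsAlgebraic R L :=
    (IsFractionRing.comap_isAlgebraic_iff (K := FractionRing R)).2 inferInstance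
  exact (IsTranscendenceBasis.mvPolynomial ι k).algebraMap_comp (A := L)

theorem SmoothProjCurve.exists_isTranscendenceBasis {k : Type u} [Field k]
    (C : SmoothProjCurve k) :
    ∃ x : Fin 1 → C.FunctionField, IsTranscendenceBasis k x := by
  obtain ⟨U, hU, V, hV, hx, e, hf⟩ :=
    C.smooth.exists_isStandardSmoothOfRelativeDimension (genericPoint C.X)
  obtain ⟨g, hg, hget⟩ := hf.exists_etale_mvPolynomial
  -- Spec k has a single point.
  obtain rfl : U = ⊤ := by
    refine top_unique fun y _ ↦ ?_
    rw [Subsingleton.elim y (C.str (genericPoint C.X))]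
    exact e hx
  let i := (Scheme.ΓSpecIso (CommRingCat.of k)).inv.hom
  let g' : MvPolynomial (Fin 1) k →+* Γ(C.X, V) := g.comp (MvPolynomial.map i)
  have hg' : g'.Etale := by
    refine RingHom.Etale.stableUnderComposition _ _ (RingHom.Etale.of_bijective ?_) hget
    exact (MvPolynomial.mapEquiv (Fin 1)
      (Scheme.ΓSpecIso (CommRingCat.of k)).symm.commRingCatIsoToRingEquiv).bijective
  have : Nonempty V := ⟨⟨_, hx⟩⟩
  let : Algebra Γ(C.X, V) C.FunctionField := (C.X.germToFunctionField V).hom.toAlgebra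
  have : IsFractionRing Γ(C.X, V) C.FunctionField :=
    functionField_isFractionRing_of_isAffineOpen C.X V hV
  refine ⟨_, isTranscendenceBasis_of_etale_mvPolynomial g' hg' ?_⟩
  have h1 : C.str.appTop ≫ C.X.presheaf.germ ⊤ (genericPoint C.X) trivial =
      C.str.appLE ⊤ V e ≫ C.X.presheaf.germ V (genericPoint C.X) hx := by
    rw [Scheme.Hom.appLE, Category.assoc, TopCat.Presheaf.germ_res]
    rfl
  have h2 : g'.comp MvPolynomial.C = (C.str.appLE ⊤ V e).hom.comp i := by
    rw [← hg]
    ext x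
    simp [g']
  rw [h2]
  change _ = ((Scheme.ΓSpecIso (CommRingCat.of k)).inv ≫ C.str.appTop ≫
    C.X.presheaf.germ ⊤ (genericPoint C.X) trivial).hom
  rw [h1]
  rfl

end FunctionField

/-! ### Assembly -/

section Main

-- Since F is algebraic over k, an element transcendental over k remains so over F; letting X act as
-- this element gives the F[X]-structure required by the preceding results.
open Polynomial in
theorem IsTranscendenceBasis.exists_algebra_polynomial {k F Ω : Type*} [Field k] [Field F]
    [Field Ω] [Algebra k F] [Algebra k Ω] [Algebra F Ω] [IsScalarTower k F Ω]
    [Algebra.IsAlgebraic k F] {y : Fin 1 → Ω} (hy : IsTranscendenceBasis k y) :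
    ∃ (_ : Algebra F[X] Ω), IsScalarTower F F[X] Ω ∧ FaithfulSMul F[X] Ω ∧
      Algebra.IsAlgebraic F[X] Ω := by
  have hrange : Set.range y = {y 0} := by
    rw [Set.range_unique]
    rfl
  have halg := hrange ▸ hy.isAlgebraic
  have ht : Transcendental F (y 0) := (hy.1.transcendental 0).extendScalars F
  let : Algebra k[X] Ω := (aeval (y 0) : k[X] →ₐ[k] Ω).toRingHom.toAlgebra
  let : Algebra F[X] Ω := (aeval (y 0) : F[X] →ₐ[F] Ω).toRingHom.toAlgebra
  let : Algebra k[X] F[X] := (mapRingHom (algebraMap k F)).toAlgebra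
  have : IsScalarTower k[X] F[X] Ω := .of_algebraMap_eq fun p ↦
    (aeval_map_algebraMap F (y 0) p).symm
  have hinj : Function.Injective (algebraMap k[X] F[X]) :=
    map_injective _ (algebraMap k F).injective
  refine ⟨inferInstance, .of_algebraMap_eq fun c ↦ ((aeval (y 0) : F[X] →ₐ[F] Ω).commutes c).symm,
    (faithfulSMul_iff_algebraMap_injective _ _).2 (transcendental_iff_injective.1 ht), ⟨fun x ↦ ?_⟩⟩
  have hx : IsAlgebraic k[X] x := by
    refine (halg.isAlgebraic x).of_ringHom_of_comp_eq
      ((aeval (y 0)).codRestrict (Algebra.adjoin k {y 0}) fun p ↦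
        aeval_mem_adjoin_singleton k _).toRingHom (RingHom.id Ω) ?_ Function.injective_id ?_
    · rintro ⟨z, hz⟩
      rw [Algebra.adjoin_singleton_eq_range_aeval] at hz
      obtain ⟨p, rfl⟩ := hz
      exact ⟨p, rfl⟩
    · rfl
  exact hx.extendScalars hinj

theorem lemma2p1 (k : Type u) [Field k] [Finite k] (C : SmoothProjCurve k)
    (Ω : Type v) [Field Ω] [Algebra C.FunctionField Ω] [IsAlgClosure C.FunctionField Ω]
    [Algebra k Ω] [IsScalarTower k C.FunctionField Ω] :
    -- (i)
    IsDomain (RingD k Ω) ∧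
    -- (ii)
    (∀ P : Ideal (RingD k Ω), P.IsPrime → P ≠ ⊥ → P.IsMaximal) ∧
    -- (iii)
    IsNondiscreteRankOneValuationRing (LocalRingAtDiag k Ω) ∧
    -- (iv)
    (∀ M : Ideal (RingD k Ω), M.IsMaximal →
      ∃! θ : Ω ≃ₐ[algebraicClosure k Ω] Ω,
        M = RingHom.ker ((diagEval k Ω).comp (oneTensor θ).toAlgHom)) := by
  have : IsAlgClosed Ω := IsAlgClosure.isAlgClosed C.FunctionField
  have : Algebra.IsAlgebraic C.FunctionField Ω := IsAlgClosure.isAlgebraic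
  have : IsAlgClosed (algebraicClosure k Ω) := IsAlgClosure.isAlgClosed k
  obtain ⟨x, hx⟩ := C.exists_isTranscendenceBasis
  obtain ⟨_, _, _, _⟩ := (hx.algebraMap_comp (A := Ω)).exists_algebra_polynomial
    (F := algebraicClosure k Ω)
  obtain ⟨p, hp⟩ := CharP.exists k
  -- Finiteness of k enters only here, to make the characteristic positive.
  have : Fact p.Prime := ⟨CharP.char_is_prime k p⟩
  have : CharP Ω p := charP_of_injective_algebraMap (algebraMap k Ω).injective p
  have hdom : IsDomain (RingD k Ω) := isDomain_tensorProduct_of_isAlgClosed _ Ω Ω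
  have : Nontrivial (RingD k Ω) := hdom.toNontrivial
  have hfield : ¬ IsField (RingD k Ω) := by
    refine not_isField_tensorProduct (t := algebraMap (Polynomial (algebraicClosure k Ω)) Ω .X) ?_
    rintro ⟨c, hc⟩
    rw [IsScalarTower.algebraMap_apply _ (Polynomial (algebraicClosure k Ω)) Ω] at hc
    exact Polynomial.X_ne_C c (FaithfulSMul.algebraMap_injective _ _ hc).symm
  have hdiag : diagIdeal k Ω ≠ ⊥ := Ring.ne_bot_of_isMaximal_of_not_isField inferInstance hfield
  exact ⟨hdom,
    fun P _ hP ↦ isMaximal_of_isPrime_tensorProduct P hP,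
    isNondiscreteRankOneValuationRing_localization p _ hdiag,
    fun M hM ↦ existsUnique_eq_ker_of_isMaximal M
      (Ring.ne_bot_of_isMaximal_of_not_isField hM hfield)⟩

end Main
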